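/- Let $(\sigma_1,\sigma_2,\sigma_3)=(X,Y,Z)$ be the Pauli matrices and, for $a\in\{0,1\}$, $x\in\{1,2,3\}$, $y\in\{0,1\}$, put $$\sigma_{a|xy}=\tfrac14\bigl(\mathbb I+(-1)^{a+\delta_{x,2}\delta_{y,1}}\sigma_x\bigr).$$ Then the following hold. 1. $\{\sigma_{a|xy}\}$ is a non-signalling Bob-with-input assemblage: $\sigma_{a|xy}\ge 0$, $\sum_a\sigma_{a|xy}$ does not depend on $x$, $\operatorname{tr}\sigma_{a|xy}$ is a real number that does not depend on $y$, and $\operatorname{tr}\sum_a\sigma_{a|xy}=1$. 2. $\sigma_{a|xy}=\mathcal T_y\bigl[\operatorname{tr}_A\{(P_{a|x}\otimes\mathbb I)|\Phi\rangle\langle\Phi|\}\bigr]$, where $|\Phi\rangle=(|00\rangle+|11\rangle)/\sqrt2$ is maximally entangled, $P_{a|x}=\frac12(\mathbb I+(-1)^{a+\delta_{x,2}}\sigma_x)$ is the measurement of $\sigma_x$ (with the two outcome labels of $Y$ interchanged), $\mathcal T_0$ is the identity and $\mathcal T_1$ is the transpose. 3. $\{\sigma_{a|xy}\}$ has no quantum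 realisation: there are no Hilbert space $\mathcal H_A$ (of any dimension), finite-dimensional $\mathcal H_B$, POVMs $\{M_{a|x}\}_a$ on $\mathcal H_A$, density operator $\rho$ on $\mathcal H_A\otimes\mathcal H_B$ and completely positive trace-preserving maps $\mathcal E_y$ from operators on $\mathcal H_B$ to operators on $\mathbb C^2$ such that $\sigma_{a|xy}=\mathcal E_y\bigl[\operatorname{tr}_A\{(M_{a|x}\otimes\mathbb I)\rho\}\bigr]$ for all $a,x,y$. 4. For every POVM $\{N_b\}_b$ on $\mathbb C^2$ with finitely many outcomes, $p(ab|xy)=\operatorname{tr}\{N_b\,\sigma_{a|xy}\}$ are quantum Bell correlations: there are finite-dimensional Hilbert spaces $\mathcal H_A,\mathcal H_B$, POVMs $\{M_{a|x}\}_a$ on $\mathcal H_A$ and $\{M'_{b|y}\}_b$ on $\mathcal H_B$, and a density operator $\rho$ on $\mathcal H_A\otimes\mathcal H_B$ with $p(ab|xy)=\operatorname{tr}\{(M_{a|x}\otimes M'_{b|y})\rho\}$. More generally, for every family of such POVMs $\{N_{b|z}\}_b$, $p(ab|xyz)=\operatorname{tr}\{N_{b|z}\,\sigma_{a|xy}\}$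 are quantum Bell correlations, $(y,z)$ being Bob's input. In particular, post-quantum steering in the Bob-with-input scenario does not imply post-quantum nonlocality. -/

import Mathlib

open scoped TensorProduct Kronecker ComplexOrder

universe u v w

noncomputable section

namespace Steering

/-! ### Matrices: measurements, states, channels -/

/-- A POVM with finitely many outcomes on `ℂ^d`. -/
def IsPOVM {B d : Type*} [Fintype B] [Fintype d] [DecidableEq d] (N : B → Matrix d d ℂ) : Prop :=
  (∀ b, (N b).PosSemidef) ∧ ∑ b, N b = 1

/-- A density matrix. -/
def IsDensityMatrix {d : Type*} [Fintype d] (ρ : Matrix d d ℂ) : Prop :=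
  ρ.PosSemidef ∧ ρ.trace = 1

/-- `id_k ⊗ E` applied to a matrix on `ℂ^k ⊗ ℂ^d`: the map `E` is applied to each of the
`k × k` blocks, which are `d × d` matrices. -/
def ampliation {d d' : Type*} (k : ℕ) (E : Matrix d d ℂ →ₗ[ℂ] Matrix d' d' ℂ)
    (P : Matrix (Fin k × d) (Fin k × d) ℂ) : Matrix (Fin k × d') (Fin k × d') ℂ :=
  Matrix.of fun r s => E (Matrix.of fun p q => P (r.1, p) (s.1, q)) r.2 s.2

/-- Completely positive and trace-preserving maps. -/
def IsCPTP {d d' : Type*} [Fintype d] [Fintype d']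
    (E : Matrix d d ℂ →ₗ[ℂ] Matrix d' d' ℂ) : Prop :=
  (∀ (k : ℕ) (P : Matrix (Fin k × d) (Fin k × d) ℂ), P.PosSemidef → (ampliation k E P).PosSemidef) ∧
    ∀ P, (E P).trace = P.trace

/-- Partial trace over the first factor of `ℂ^c ⊗ ℂ^d`. -/
def traceFst {c d : Type*} [Fintype c] (P : Matrix (c × d) (c × d) ℂ) : Matrix d d ℂ :=
  Matrix.of fun i j => ∑ k, P (k, i) (k, j)

/-! ### Operators on `H ⊗ ℂ^n`, for an arbitrary Hilbert space `H` -/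

section Operators

variable {H : Type*} [NormedAddCommGroup H] [InnerProductSpace ℂ H]

/-- A POVM with finitely many outcomes on a Hilbert space `H`. -/
def IsOperatorPOVM {A : Type*} [Fintype A] (M : A → H →L[ℂ] H) : Prop :=
  (∀ a, (M a).IsPositive) ∧ ∑ a, M a = 1

/-- The space `H ⊗ ℂ^n`; as the second factor is finite-dimensional, the algebraic tensor product
with its inner product is already the tensor product of Hilbert spaces. -/
abbrev Joint (H : Type*) [NormedAddCommGroup H] [InnerProductSpace ℂ H] (n : ℕ) : Type _ :=
  H ⊗[ℂ] EuclideanSpace ℂ (Fin n)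

/-- The vector `e_k ⊗ |i⟩`, for an orthonormal basis `e` of `H`. -/
def jointBasis {ι : Type*} {n : ℕ} (e : HilbertBasis ι ℂ H) (k : ι) (i : Fin n) : Joint H n :=
  e k ⊗ₜ[ℂ] EuclideanSpace.single i (1 : ℂ)

/-- Density operators on `H ⊗ ℂ^n`: positive bounded operators of trace one. The trace is computed
in the orthonormal basis `e_k ⊗ |i⟩`; for positive operators it does not depend on the basis. -/
def IsDensityOperator {ι : Type*} {n : ℕ} (e : HilbertBasis ι ℂ H)
    (ρ : Joint H n →L[ℂ] Joint H n) : Prop :=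
  ρ.IsPositive ∧
    HasSum (fun k : ι × Fin n => inner ℂ (jointBasis e k.1 k.2) (ρ (jointBasis e k.1 k.2))) 1

/-- `τ = tr_H T`, with matrix entries `⟨i|τ|j⟩ = ∑_k ⟨e_k ⊗ i, T (e_k ⊗ j)⟩`. -/
def IsPartialTrace {ι : Type*} {n : ℕ} (e : HilbertBasis ι ℂ H)
    (T : Joint H n →ₗ[ℂ] Joint H n) (τ : Matrix (Fin n) (Fin n) ℂ) : Prop :=
  ∀ i j, HasSum (fun k : ι => inner ℂ (jointBasis e k i) (T (jointBasis e k j))) (τ i j)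

end Operators

/-! ### Bob-with-input assemblages

`σ a x y` stands for `σ_{a|xy}`. -/

/-- Non-signalling Bob-with-input assemblages. -/
def IsNonSignalling {A X Y d : Type} [Fintype A] [Fintype d]
    (σ : A → X → Y → Matrix d d ℂ) : Prop :=
  (∀ a x y, (σ a x y).PosSemidef) ∧
  (∀ x x' y, ∑ a, σ a x y = ∑ a, σ a x' y) ∧
  (∃ p : A → X → ℝ, ∀ a x y, (σ a x y).trace = (p a x : ℂ)) ∧
  ∀ x y, (∑ a, σ a x y).trace = 1

/-- Quantum Bob-with-input assemblages: there are a Hilbert space `H` and POVMs `M_{·|x}` on it for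
Alice, a state `ρ` on `H ⊗ ℂ^n`, and CPTP maps `E_y` for Bob such that
`σ_{a|xy} = E_y [tr_H ((M_{a|x} ⊗ 1) ρ)]`. The system of dimension `n` on which Bob's maps act may
differ from their output system, on which the assemblage lives. -/
def IsQuantumRealisable {A X Y d : Type} [Fintype A] [Fintype d]
    (σ : A → X → Y → Matrix d d ℂ) : Prop :=
  ∃ (H : Type u) (_ : NormedAddCommGroup H) (_ : InnerProductSpace ℂ H) (_ : CompleteSpace H)
    (ι : Type u) (e : HilbertBasis ι ℂ H) (n : ℕ)
    (M : A → X → H →L[ℂ] H) (ρ : Joint H n →L[ℂ] Joint H n)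
    (τ : A → X → Matrix (Fin n) (Fin n) ℂ)
    (E : Y → Matrix (Fin n) (Fin n) ℂ →ₗ[ℂ] Matrix d d ℂ),
    (∀ x, IsOperatorPOVM (fun a => M a x)) ∧
    IsDensityOperator e ρ ∧
    (∀ a x, IsPartialTrace e
      ((M a x).toLinearMap.rTensor (EuclideanSpace ℂ (Fin n)) ∘ₗ ρ.toLinearMap) (τ a x)) ∧
    (∀ y, IsCPTP (E y)) ∧
    ∀ a x y, σ a x y = E y (τ a x)

/-! ### Bell correlations -/

/-- Quantum Bell correlations `p(ab|xy) = tr ((M_{a|x} ⊗ N_{b|y}) ρ)`, with finite-dimensional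
local systems; `p a b x y` stands for `p(ab|xy)`. -/
def IsQuantumBell {A B X Y : Type*} [Fintype A] [Fintype B] (p : A → B → X → Y → ℂ) : Prop :=
  ∃ (m n : ℕ) (M : A → X → Matrix (Fin m) (Fin m) ℂ) (N : B → Y → Matrix (Fin n) (Fin n) ℂ)
    (ρ : Matrix (Fin m × Fin n) (Fin m × Fin n) ℂ),
    (∀ x, IsPOVM (fun a => M a x)) ∧ (∀ y, IsPOVM (fun b => N b y)) ∧ IsDensityMatrix ρ ∧
    ∀ a b x y, p a b x y = ((M a x ⊗ₖ N b y) * ρ).trace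

/-! ### The example -/

/-- The Pauli matrices `X, Y, Z`; the labels `1, 2, 3` are `0, 1, 2` here. -/
def pauli : Fin 3 → Matrix (Fin 2) (Fin 2) ℂ :=
  ![!![0, 1; 1, 0], !![0, -Complex.I; Complex.I, 0], !![1, 0; 0, -1]]

/-- The exponent `δ_{x,2}`: one for the Pauli matrix `Y`, zero for `X` and `Z`. -/
def deltaY (x : Fin 3) : ℕ := if x = 1 then 1 else 0

/-- `σ_{a|xy} = (1 + (-1)^{a + δ_{x,2} δ_{y,1}} σ_x) / 4`. -/
def exampleAssemblage (a : Fin 2) (x : Fin 3) (y : Fin 2) : Matrix (Fin 2) (Fin 2) ℂ :=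
  (1 / 4 : ℂ) • (1 + (-1 : ℂ) ^ ((a : ℕ) + deltaY x * (if y = 1 then 1 else 0)) • pauli x)

/-- The measurement of the Pauli observable `σ_x`, with the two outcomes of `Y` labelled in the
opposite order: the projections `(1 + (-1)^{a + δ_{x,2}} σ_x) / 2`. -/
def pauliMeasurement (a : Fin 2) (x : Fin 3) : Matrix (Fin 2) (Fin 2) ℂ :=
  (1 / 2 : ℂ) • (1 + (-1 : ℂ) ^ ((a : ℕ) + deltaY x) • pauli x)

/-- The maximally entangled vector `(|00⟩ + |11⟩) / √2`. -/
def phiPlus : Fin 2 × Fin 2 → ℂ := fun p => if p.1 = p.2 then ((√2 : ℝ) : ℂ)⁻¹ else 0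

/-- The projection onto the maximally entangled vector. -/
def maxEntangled : Matrix (Fin 2 × Fin 2) (Fin 2 × Fin 2) ℂ :=
  Matrix.vecMulVec phiPlus (star phiPlus)

/-- The identity for `y = 0` and the transpose for `y = 1`. -/
def bobMap (y : Fin 2) (P : Matrix (Fin 2) (Fin 2) ℂ) : Matrix (Fin 2) (Fin 2) ℂ :=
  if y = 0 then P else P.transpose

end Steering

end

/-!
Suppose that Bob's map `E_y` produced the assemblage from the states `τ_{a|x}` to which Alice steers
him. Put `T = τ_{0|x} + τ_{1|x}`, which does not depend on `x`, and `D_x = τ_{0|x} - τ_{1|x}`;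
neither depends on `y`. Each member of the assemblage is proportional to an eigenprojection of
`S_x`, where `S_x = σ_x` for `y = 0` and `S_x = σ_xᵀ` for `y = 1`. Hence a Stinespring isometry `V`
of `E_y` satisfies `V D_x = (1 ⊗ S_x) V T`, and products of the `S_x` turn into products of the
`D_x`: `D_x D_z = (V T)ᴴ (1 ⊗ S_x S_z) (V T)`. As the transpose reverses products, `X Z = -i Y`
gives `D_X D_Z = -i T D_Y` for `y = 0` and `D_X D_Z = i T D_Y` for `y = 1`. So `T D_Y = 0`, which
together with `D_Y² = T²` forces `T = 0`, against `tr T = 1`.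

For an infinite-dimensional system of Alice, the matrices `τ_{a|x}` are positive because the
compressions `⟨v|ρ|v⟩` are positive operators of finite trace, and `tr (M R²) = tr (R M R) ≥ 0` for
positive `M` and Hilbert–Schmidt `R ≥ 0`.

When Bob measures, his transposition can be moved from the state to the measurement
operators, which remain a POVM because the transpose is positive and unital.
-/

namespace Steering

open Matrix

noncomputable section

section HilbertSchmidt

variable {𝕜 H K ι κ : Type*} [RCLike 𝕜] [NormedAddCommGroup H] [InnerProductSpace 𝕜 H]
  [NormedAddCommGroup K] [InnerProductSpace 𝕜 K]

theorem hasSum_sq_norm_inner (e : HilbertBasis ι 𝕜 H) (x : H) :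
    HasSum (fun k => ‖inner 𝕜 (e k) x‖ ^ 2) (‖x‖ ^ 2) := by
  have h := RCLike.hasSum_re 𝕜 (e.hasSum_inner_mul_inner x x)
  simpa only [inner_mul_symm_re_eq_norm, norm_mul, norm_inner_symm x, ← sq,
    inner_self_eq_norm_sq] using h

theorem hasSum_inner_apply_mul_inner (e : HilbertBasis ι 𝕜 H) (A : H →L[𝕜] K) (g : K) (x : H) :
    HasSum (fun k => inner 𝕜 g (A (e k)) * inner 𝕜 (e k) x) (inner 𝕜 g (A x)) := by
  have h := ((innerSL 𝕜 g).comp A).hasSum (e.hasSum_repr x)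
  simpa [Function.comp_def, e.repr_apply_apply, inner_smul_right, mul_comm] using h

/-- Hilbert–Schmidt operators. Square-summability is only required in the given orthonormal basis,
which spares the proof that it does not depend on the basis. -/
def IsHilbertSchmidt (e : HilbertBasis ι 𝕜 H) (A : H →L[𝕜] K) : Prop :=
  Summable fun k => ‖A (e k)‖ ^ 2

variable {e : HilbertBasis ι 𝕜 H}

theorem IsHilbertSchmidt.clm_comp {L : Type*} [NormedAddCommGroup L] [InnerProductSpace 𝕜 L]
    {A : H →L[𝕜] K} (hA : IsHilbertSchmidt e A) (M : K →L[𝕜] L) :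
    IsHilbertSchmidt e (M ∘L A) := by
  refine (hA.mul_left (‖M‖ ^ 2)).of_nonneg_of_le (fun k => by positivity) fun k => ?_
  rw [← mul_pow]
  gcongr
  exact M.le_opNorm _

theorem IsHilbertSchmidt.summable_sq_norm_inner {A : H →L[𝕜] K} (hA : IsHilbertSchmidt e A)
    (f : HilbertBasis κ 𝕜 K) :
    Summable fun p : ι × κ => ‖inner 𝕜 (f p.2) (A (e p.1))‖ ^ 2 := by
  rw [summable_prod_of_nonneg fun p => by positivity]
  refine ⟨fun k => (hasSum_sq_norm_inner f (A (e k))).summable, ?_⟩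
  simpa only [(hasSum_sq_norm_inner f _).tsum_eq, IsHilbertSchmidt] using hA

/-- The trace of a product of Hilbert–Schmidt operators is cyclic: both traces are the sum of the
absolutely summable family `⟨f_l, A e_k⟩ ⟨e_k, B f_l⟩`. -/
theorem IsHilbertSchmidt.exists_hasSum_inner_comp {A : H →L[𝕜] K} (hA : IsHilbertSchmidt e A)
    {f : HilbertBasis κ 𝕜 K} {B : K →L[𝕜] H} (hB : IsHilbertSchmidt f B) :
    ∃ t, HasSum (fun l => inner 𝕜 (f l) (A (B (f l)))) t ∧
      HasSum (fun k => inner 𝕜 (e k) (B (A (e k)))) t := by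
  have hAB : Summable fun p : ι × κ =>
      inner 𝕜 (f p.2) (A (e p.1)) * inner 𝕜 (e p.1) (B (f p.2)) := by
    refine .of_norm_bounded
      ((hA.summable_sq_norm_inner f).add (hB.summable_sq_norm_inner e).prod_symm) fun p => ?_
    rw [norm_mul, Prod.fst_swap, Prod.snd_swap]
    nlinarith [sq_nonneg (‖inner 𝕜 (f p.2) (A (e p.1))‖ - ‖inner 𝕜 (e p.1) (B (f p.2))‖),
      sq_nonneg ‖inner 𝕜 (f p.2) (A (e p.1))‖, sq_nonneg ‖inner 𝕜 (e p.1) (B (f p.2))‖]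
  obtain ⟨t, ht⟩ := hAB
  refine ⟨t, ((Equiv.prodComm κ ι).hasSum_iff.2 ht).prod_fiberwise fun l => ?_,
    ht.prod_fiberwise fun k => ?_⟩
  · exact hasSum_inner_apply_mul_inner e A (f l) (B (f l))
  · simpa only [mul_comm] using hasSum_inner_apply_mul_inner f B (e k) (A (e k))

end HilbertSchmidt

section SteeredStates

variable {H ι : Type*} [NormedAddCommGroup H] [InnerProductSpace ℂ H] {n : ℕ}
  {e : HilbertBasis ι ℂ H}

theorem exists_isHilbertSchmidt_mul_self_eq [CompleteSpace H] {P : H →L[ℂ] H} (hP : P.IsPositive)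
    (hs : Summable fun k => inner ℂ (e k) (P (e k))) :
    ∃ R : H →L[ℂ] H, R.IsPositive ∧ IsHilbertSchmidt e R ∧ R * R = P := by
  have hR := (ContinuousLinearMap.nonneg_iff_isPositive _).1 (CFC.sqrt_nonneg P)
  have hRR := CFC.sqrt_mul_sqrt_self P ((ContinuousLinearMap.nonneg_iff_isPositive _).2 hP)
  refine ⟨CFC.sqrt P, hR, ?_, hRR⟩
  refine (Complex.hasSum_re hs.hasSum).summable.congr fun k => ?_
  have hk : CFC.sqrt P (CFC.sqrt P (e k)) = P (e k) := DFunLike.congr_fun hRR (e k)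
  rw [← hk, ← hR.inner_left_eq_inner_right]
  exact inner_self_eq_norm_sq (𝕜 := ℂ) _

theorem nonneg_of_hasSum_inner_mul [CompleteSpace H] {M P : H →L[ℂ] H} (hM : M.IsPositive)
    (hP : P.IsPositive) (hs : Summable fun k => inner ℂ (e k) (P (e k))) {t : ℂ}
    (ht : HasSum (fun k => inner ℂ (e k) (M (P (e k)))) t) : 0 ≤ t := by
  obtain ⟨R, hR, hRe, rfl⟩ := exists_isHilbertSchmidt_mul_self_eq hP hs
  obtain ⟨s, hMRR, hRMR⟩ := (hRe.clm_comp M).exists_hasSum_inner_comp hRe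
  rw [ht.unique hMRR]
  refine hRMR.nonneg fun k => ?_
  rw [← hR.inner_left_eq_inner_right]
  exact hM.inner_nonneg_right _

/-- The contraction `h ⊗ w ↦ ⟨v, w⟩ h`, that is `1 ⊗ ⟨v|`. -/
def contractRight (H : Type*) [NormedAddCommGroup H] [InnerProductSpace ℂ H] {n : ℕ}
    (v : EuclideanSpace ℂ (Fin n)) : Joint H n →L[ℂ] H :=
  (TensorProduct.ridIsometry ℂ H).toContinuousLinearEquiv.toContinuousLinearMap ∘L
    (innerSL ℂ v).lTensor H

theorem contractRight_tmul (v w : EuclideanSpace ℂ (Fin n)) (h : H) :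
    contractRight H v (h ⊗ₜ w) = inner ℂ v w • h := by
  simp [contractRight]

theorem inner_contractRight (v : EuclideanSpace ℂ (Fin n)) (h : H) (t : Joint H n) :
    inner ℂ h (contractRight H v t) = inner ℂ (h ⊗ₜ[ℂ] v) t := by
  induction t using TensorProduct.induction_on with
  | zero => simp
  | tmul g w => rw [contractRight_tmul, inner_smul_right, TensorProduct.inner_tmul, mul_comm]
  | add a b ha hb => rw [map_add, inner_add_right, inner_add_right, ha, hb]

theorem contractRight_rTensor (v : EuclideanSpace ℂ (Fin n)) (M : H →ₗ[ℂ] H) (t : Joint H n) :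
    contractRight H v (M.rTensor _ t) = M (contractRight H v t) := by
  induction t using TensorProduct.induction_on with
  | zero => simp
  | tmul g w => rw [LinearMap.rTensor_tmul, contractRight_tmul, contractRight_tmul, map_smul]
  | add a b ha hb => simp only [map_add, ha, hb]

/-- The operator `⟨v| ρ |v⟩` on `H`, for an operator `ρ` on `H ⊗ ℂ^n`. -/
def compression (ρ : Joint H n →L[ℂ] Joint H n) (v : EuclideanSpace ℂ (Fin n)) : H →L[ℂ] H :=
  contractRight H v ∘L ρ ∘L (TensorProduct.mkL ℂ H (EuclideanSpace ℂ (Fin n))).flip v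

theorem inner_compression (ρ : Joint H n →L[ℂ] Joint H n) (v : EuclideanSpace ℂ (Fin n))
    (g h : H) : inner ℂ g (compression ρ v h) = inner ℂ (g ⊗ₜ[ℂ] v) (ρ (h ⊗ₜ[ℂ] v)) :=
  inner_contractRight v g _

theorem isPositive_compression {ρ : Joint H n →L[ℂ] Joint H n} (hρ : ρ.IsPositive)
    (v : EuclideanSpace ℂ (Fin n)) : (compression ρ v).IsPositive := by
  refine ⟨fun g h => ?_, fun h => ?_⟩
  · rw [← inner_conj_symm]
    simp only [ContinuousLinearMap.coe_coe, inner_compression]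
    exact (inner_conj_symm _ _).trans (hρ.inner_left_eq_inner_right _ _)
  · rw [ContinuousLinearMap.reApplyInnerSelf, inner_re_symm, inner_compression]
    exact hρ.re_inner_nonneg_right _

theorem tmul_eq_sum_jointBasis (e : HilbertBasis ι ℂ H) (k : ι) (v : EuclideanSpace ℂ (Fin n)) :
    e k ⊗ₜ[ℂ] v = ∑ i, v i • jointBasis e k i := by
  conv_lhs => rw [← (EuclideanSpace.basisFun (Fin n) ℂ).sum_repr v]
  simp [TensorProduct.tmul_sum, jointBasis]

theorem IsPartialTrace.hasSum_inner_tmul {T : Joint H n →ₗ[ℂ] Joint H n}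
    {τ : Matrix (Fin n) (Fin n) ℂ} (h : IsPartialTrace e T τ) (v w : EuclideanSpace ℂ (Fin n)) :
    HasSum (fun k => inner ℂ (e k ⊗ₜ[ℂ] v) (T (e k ⊗ₜ[ℂ] w))) (star v.ofLp ⬝ᵥ τ *ᵥ w.ofLp) := by
  have hsum : HasSum (fun k => ∑ i, ∑ j, star (v i) * (w j *
      inner ℂ (jointBasis e k i) (T (jointBasis e k j))))
      (∑ i, ∑ j, star (v i) * (w j * τ i j)) :=
    hasSum_sum fun i _ => hasSum_sum fun j _ => ((h i j).mul_left _).mul_left _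
  convert hsum using 1
  · funext k
    rw [tmul_eq_sum_jointBasis, tmul_eq_sum_jointBasis, map_sum, sum_inner]
    refine Finset.sum_congr rfl fun i _ => ?_
    rw [inner_sum]
    refine Finset.sum_congr rfl fun j _ => ?_
    rw [map_smul]
    exact (inner_smul_left (𝕜 := ℂ) (E := Joint H n) _ _ _).trans
      (congrArg _ (inner_smul_right (𝕜 := ℂ) (E := Joint H n) _ _ _))
  · simp only [dotProduct, mulVec, Finset.mul_sum, Pi.star_apply, mul_comm (w _)]

theorem IsPartialTrace.unique {T : Joint H n →ₗ[ℂ] Joint H n} {τ τ' : Matrix (Fin n) (Fin n) ℂ}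
    (h : IsPartialTrace e T τ) (h' : IsPartialTrace e T τ') : τ = τ' :=
  Matrix.ext fun i j => (h i j).unique (h' i j)

theorem IsPartialTrace.sum {A : Type*} {s : Finset A} {T : A → Joint H n →ₗ[ℂ] Joint H n}
    {τ : A → Matrix (Fin n) (Fin n) ℂ} (h : ∀ a ∈ s, IsPartialTrace e (T a) (τ a)) :
    IsPartialTrace e (∑ a ∈ s, T a) (∑ a ∈ s, τ a) := fun i j => by
  simpa only [LinearMap.sum_apply, inner_sum, Matrix.sum_apply] using
    hasSum_sum fun a ha => h a ha i j

theorem posSemidef_of_dotProduct_mulVec_nonneg {m : Type*} [Fintype m] {A : Matrix m m ℂ}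
    (h : ∀ x, 0 ≤ star x ⬝ᵥ A *ᵥ x) : A.PosSemidef := by
  classical
  rw [← isPositive_toEuclideanLin_iff, LinearMap.isPositive_iff_complex]
  intro v
  have hv : 0 ≤ inner ℂ (A.toEuclideanLin v) v := by
    rw [← inner_conj_symm, starRingEnd_apply, star_nonneg_iff,
      EuclideanSpace.inner_eq_star_dotProduct, dotProduct_comm]
    exact h v.ofLp
  exact ⟨RCLike.conj_eq_iff_re.1 (IsSelfAdjoint.of_nonneg hv), (Complex.nonneg_iff.1 hv).1⟩

theorem IsPartialTrace.posSemidef [CompleteSpace H] {M : H →L[ℂ] H}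
    {ρ : Joint H n →L[ℂ] Joint H n} {τ τ' : Matrix (Fin n) (Fin n) ℂ} (hM : M.IsPositive)
    (hρ : ρ.IsPositive) (hτ' : IsPartialTrace e ρ.toLinearMap τ')
    (hτ : IsPartialTrace e (M.toLinearMap.rTensor (EuclideanSpace ℂ (Fin n)) ∘ₗ ρ.toLinearMap) τ) :
    τ.PosSemidef := by
  refine posSemidef_of_dotProduct_mulVec_nonneg fun x => ?_
  have hP := isPositive_compression hρ (WithLp.toLp 2 x)
  refine nonneg_of_hasSum_inner_mul (e := e) hM hP ?_ ?_
  · simp only [inner_compression]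
    exact (hτ'.hasSum_inner_tmul _ _).summable
  · convert hτ.hasSum_inner_tmul (WithLp.toLp 2 x) (WithLp.toLp 2 x) using 2 with k
    rw [← inner_contractRight, LinearMap.comp_apply, contractRight_rTensor]
    rfl

theorem IsOperatorPOVM.sum_rTensor_comp {A G : Type*} [Fintype A] [NormedAddCommGroup G]
    [InnerProductSpace ℂ G] {M : A → H →L[ℂ] H} (hM : IsOperatorPOVM M)
    (T : H ⊗[ℂ] G →ₗ[ℂ] H ⊗[ℂ] G) : ∑ a, (M a).toLinearMap.rTensor G ∘ₗ T = T := by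
  have hid : ∑ a, (M a).toLinearMap = LinearMap.id := by
    ext x
    simpa using DFunLike.congr_fun hM.2 x
  have hsum := map_sum (LinearMap.rTensorHom G) (fun a => (M a).toLinearMap) Finset.univ
  simp only [LinearMap.coe_rTensorHom, hid, LinearMap.rTensor_id] at hsum
  refine LinearMap.ext fun t => ?_
  simpa only [LinearMap.sum_apply, LinearMap.comp_apply, LinearMap.id_apply] using
    (DFunLike.congr_fun hsum (T t)).symm

/-- Alice's part of a realisation, possibly infinite-dimensional, only enters through the finite
matrices to which she steers Bob's input system. -/
theorem IsQuantumRealisable.exists_steered {A X Y d : Type} [Fintype A] [Fintype d]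
    {σ : A → X → Y → Matrix d d ℂ} (hσ : IsQuantumRealisable.{u} σ) :
    ∃ (n : ℕ) (τ : A → X → Matrix (Fin n) (Fin n) ℂ) (T : Matrix (Fin n) (Fin n) ℂ)
      (E : Y → Matrix (Fin n) (Fin n) ℂ →ₗ[ℂ] Matrix d d ℂ),
      (∀ a x, (τ a x).PosSemidef) ∧ (∀ x, ∑ a, τ a x = T) ∧ (∀ y, IsCPTP (E y)) ∧
        ∀ a x y, σ a x y = E y (τ a x) := by
  obtain ⟨H, _, _, _, ι, e, n, M, ρ, τ, E, hM, hρ, hτ, hE, h⟩ := hσ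
  have hsum (x : X) : IsPartialTrace e ρ.toLinearMap (∑ a, τ a x) := by
    have h := IsPartialTrace.sum (s := Finset.univ) fun a _ => hτ a x
    rwa [(hM x).sum_rTensor_comp] at h
  obtain ⟨T, hT⟩ : ∃ T, ∀ x, ∑ a, τ a x = T := by
    rcases isEmpty_or_nonempty X with _ | ⟨⟨x₀⟩⟩
    · exact ⟨0, isEmptyElim⟩
    · exact ⟨_, fun x => (hsum x).unique (hsum x₀)⟩
  exact ⟨n, τ, T, E, fun a x => IsPartialTrace.posSemidef ((hM x).1 a) hρ.1 (hsum x) (hτ a x),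
    hT, hE, h⟩

end SteeredStates

section Dilation

variable {κ c d : Type*} [Fintype κ] [Fintype c]

theorem exists_mul_conjTranspose_eq {A : Matrix c c ℂ} (hA : A.PosSemidef) :
    ∃ B : Matrix c c ℂ, B * Bᴴ = A := by
  classical
  open scoped MatrixOrder Matrix.Norms.L2Operator in
  obtain ⟨B, hB⟩ := CStarAlgebra.nonneg_iff_eq_star_mul_self.mp hA.nonneg
  exact ⟨Bᴴ, by rw [conjTranspose_conjTranspose, hB, star_eq_conjTranspose]⟩

theorem trace_traceFst [Fintype d] (R : Matrix (κ × d) (κ × d) ℂ) :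
    (traceFst R).trace = R.trace := by
  simp only [trace, diag_apply, traceFst, of_apply, Fintype.sum_prod_type_right]

theorem one_kronecker_mul_apply [Fintype d] [DecidableEq κ] {l : Type*} (Q : Matrix d d ℂ)
    (R : Matrix (κ × d) l ℂ) (k : κ) (i : d) (j : l) :
    (((1 : Matrix κ κ ℂ) ⊗ₖ Q) * R) (k, i) j = ∑ r, Q i r * R (k, r) j := by
  simp [mul_apply, Fintype.sum_prod_type, kroneckerMap_apply, one_apply, ite_mul]

theorem traceFst_one_kronecker_mul [Fintype d] [DecidableEq κ] (Q : Matrix d d ℂ)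
    (R : Matrix (κ × d) (κ × d) ℂ) :
    traceFst (((1 : Matrix κ κ ℂ) ⊗ₖ Q) * R) = Q * traceFst R := by
  ext i j
  simp only [traceFst, of_apply, one_kronecker_mul_apply]
  simp only [Matrix.mul_apply, of_apply, Finset.mul_sum]
  exact Finset.sum_comm

theorem trace_one_kronecker_mul [Fintype d] [DecidableEq κ] (Q : Matrix d d ℂ)
    (R : Matrix (κ × d) (κ × d) ℂ) :
    (((1 : Matrix κ κ ℂ) ⊗ₖ Q) * R).trace = (Q * traceFst R).trace := by
  rw [← traceFst_one_kronecker_mul, trace_traceFst]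

/-- The map `P ↦ tr_κ (V P Vᴴ)`: the Stinespring form of a completely positive map. -/
def dilatedChannel (V : Matrix (κ × d) c ℂ) : Matrix c c ℂ →ₗ[ℂ] Matrix d d ℂ where
  toFun P := traceFst (V * P * Vᴴ)
  map_add' P Q := by
    ext i j
    simp [traceFst, Matrix.mul_add, Matrix.add_mul, Finset.sum_add_distrib]
  map_smul' s P := by
    ext i j
    simp [traceFst, Finset.mul_sum]

theorem dilatedChannel_apply (V : Matrix (κ × d) c ℂ) (P : Matrix c c ℂ) :
    dilatedChannel V P = traceFst (V * P * Vᴴ) :=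
  rfl

theorem trace_dilatedChannel [Fintype d] (V : Matrix (κ × d) c ℂ) (P : Matrix c c ℂ) :
    (dilatedChannel V P).trace = (Vᴴ * V * P).trace := by
  rw [dilatedChannel_apply, trace_traceFst, trace_mul_cycle]

omit [Fintype κ] in
theorem mul_single_mul_conjTranspose_apply [DecidableEq c] (V : Matrix κ c ℂ) (i j : c)
    (k l : κ) : (V * single i j (1 : ℂ) * Vᴴ) k l = V k i * star (V l j) := by
  rw [Matrix.mul_assoc, Matrix.mul_apply, Finset.sum_eq_single i (by simp +contextual) (by simp)]
  simp

/-- **Stinespring's theorem**, with the isometry `V` read off from a factorisation of the Choi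
matrix of `E`. -/
theorem IsCPTP.exists_eq_dilatedChannel [DecidableEq c] [Fintype d]
    {E : Matrix c c ℂ →ₗ[ℂ] Matrix d d ℂ} (hE : IsCPTP E) :
    ∃ V : Matrix ((Fin (Fintype.card c) × d) × d) c ℂ, E = dilatedChannel V ∧ Vᴴ * V = 1 := by
  let f := Fintype.equivFin c
  let ω : Fin (Fintype.card c) × c → ℂ := fun p => if f.symm p.1 = p.2 then 1 else 0
  obtain ⟨B, hB⟩ := exists_mul_conjTranspose_eq (hE.1 _ _ (posSemidef_vecMulVec_self_star ω))
  let V : Matrix ((Fin (Fintype.card c) × d) × d) c ℂ := of fun p i => B (f i, p.2) p.1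
  have hblock (i j : c) :
      (of fun p q => vecMulVec ω (star ω) (f i, p) (f j, q)) = single i j (1 : ℂ) := by
    ext p q
    by_cases hp : i = p <;> by_cases hq : j = q <;> simp [ω, vecMulVec_apply, single, hp, hq]
  have hV : E = dilatedChannel V := by
    refine ext_linearMap ℂ fun i j => LinearMap.ext_ring ?_
    ext r s
    have hrs := congrFun₂ hB (f i, r) (f j, s)
    rw [ampliation, of_apply, hblock] at hrs
    simp only [LinearMap.comp_apply, singleLinearMap_apply, ← hrs, dilatedChannel_apply, traceFst,
      of_apply, mul_single_mul_conjTranspose_apply]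
    rfl
  refine ⟨V, hV, ext_iff_trace_mul_right.2 fun P => ?_⟩
  rw [← trace_dilatedChannel, ← hV, hE.2, Matrix.one_mul]

variable [Fintype d] [DecidableEq κ] {V : Matrix (κ × d) c ℂ}

theorem one_kronecker_mul_eq_zero {P : Matrix c c ℂ} (hP : P.PosSemidef) {Q : Matrix d d ℂ}
    (h : Q * dilatedChannel V P = 0) : ((1 : Matrix κ κ ℂ) ⊗ₖ Q) * (V * P) = 0 := by
  obtain ⟨B, rfl⟩ := exists_mul_conjTranspose_eq hP
  suffices hW : ((1 : Matrix κ κ ℂ) ⊗ₖ Q) * (V * B) = 0 by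
    rw [← Matrix.mul_assoc V, ← Matrix.mul_assoc, hW, Matrix.zero_mul]
  rw [← trace_mul_conjTranspose_self_eq_zero_iff]
  calc (((1 : Matrix κ κ ℂ) ⊗ₖ Q) * (V * B) * (((1 : Matrix κ κ ℂ) ⊗ₖ Q) * (V * B))ᴴ).trace
      = (((1 : Matrix κ κ ℂ) ⊗ₖ Qᴴ) *
          (((1 : Matrix κ κ ℂ) ⊗ₖ Q) * (V * (B * Bᴴ) * Vᴴ))).trace := by
        rw [conjTranspose_mul, conjTranspose_kronecker, conjTranspose_one, ← Matrix.mul_assoc,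
          trace_mul_comm, conjTranspose_mul]
        simp only [Matrix.mul_assoc]
    _ = (Qᴴ * (Q * dilatedChannel V (B * Bᴴ))).trace := by
        rw [trace_one_kronecker_mul, traceFst_one_kronecker_mul, dilatedChannel_apply]
    _ = 0 := by rw [h, Matrix.mul_zero, trace_zero]

theorem one_kronecker_mul_eq_smul {P : Matrix c c ℂ} (hP : P.PosSemidef) {S : Matrix d d ℂ} {s : ℂ}
    (h : S * dilatedChannel V P = s • dilatedChannel V P) :
    ((1 : Matrix κ κ ℂ) ⊗ₖ S) * (V * P) = s • (V * P) := by
  classical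
  have h0 : (S - s • 1) * dilatedChannel V P = 0 := by
    rw [Matrix.sub_mul, h, Matrix.smul_mul, Matrix.one_mul, sub_self]
  have hVP := one_kronecker_mul_eq_zero hP h0
  rwa [sub_eq_add_neg, kronecker_add, ← neg_smul, kronecker_smul, one_kronecker_one,
    Matrix.add_mul, Matrix.smul_mul, Matrix.one_mul, neg_smul, ← sub_eq_add_neg, sub_eq_zero]
    at hVP

/-- The map `A ↦ Wᴴ (1 ⊗ A) W`, the dual of `dilatedChannel W` for the trace pairing (the Heisenberg
picture). -/
def heisenbergDual (W : Matrix (κ × d) c ℂ) : Matrix d d ℂ →ₗ[ℂ] Matrix c c ℂ where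
  toFun A := Wᴴ * (((1 : Matrix κ κ ℂ) ⊗ₖ A) * W)
  map_add' A B := by rw [kronecker_add, Matrix.add_mul, Matrix.mul_add]
  map_smul' s A := by
    rw [kronecker_smul, Matrix.smul_mul, Matrix.mul_smul, RingHom.id_apply]

theorem heisenbergDual_conjTranspose_mul [DecidableEq c] (hV : Vᴴ * V = 1)
    {W : Matrix (κ × d) c ℂ} {S S' : Matrix d d ℂ} {D D' : Matrix c c ℂ}
    (h : ((1 : Matrix κ κ ℂ) ⊗ₖ S) * W = V * D) (h' : ((1 : Matrix κ κ ℂ) ⊗ₖ S') * W = V * D') :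
    heisenbergDual W (Sᴴ * S') = Dᴴ * D' :=
  calc Wᴴ * (((1 : Matrix κ κ ℂ) ⊗ₖ (Sᴴ * S')) * W)
      = (((1 : Matrix κ κ ℂ) ⊗ₖ S) * W)ᴴ * (((1 : Matrix κ κ ℂ) ⊗ₖ S') * W) := by
        rw [conjTranspose_mul, conjTranspose_kronecker, conjTranspose_one, Matrix.mul_assoc,
          ← Matrix.mul_assoc (_ ⊗ₖ _) (_ ⊗ₖ _), ← mul_kronecker_mul, Matrix.one_mul]
    _ = Dᴴ * (Vᴴ * V) * D' := by
        rw [h, h', conjTranspose_mul]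
        simp only [Matrix.mul_assoc]
    _ = Dᴴ * D' := by rw [hV, Matrix.mul_one]

theorem one_kronecker_mul_mul_sum {τ : Fin 2 → Matrix c c ℂ} (hτ : ∀ a, (τ a).PosSemidef)
    {S : Matrix d d ℂ}
    (hS : ∀ a, S * dilatedChannel V (τ a) = (-1 : ℂ) ^ (a : ℕ) • dilatedChannel V (τ a)) :
    ((1 : Matrix κ κ ℂ) ⊗ₖ S) * (V * ∑ a, τ a) = V * (τ 0 - τ 1) := by
  rw [Fin.sum_univ_two, Matrix.mul_add, Matrix.mul_add, one_kronecker_mul_eq_smul (hτ 0) (hS 0),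
    one_kronecker_mul_eq_smul (hτ 1) (hS 1), Matrix.mul_sub]
  simp [sub_eq_add_neg]

/-- If Bob's output `E (τ a x)` is supported on the `(-1)^a`-eigenspace of `S x`, then products of
the observables `S x` are reflected in products of the differences `τ 0 x - τ 1 x`. -/
theorem IsCPTP.exists_linearMap_conjTranspose_mul [DecidableEq d] {X : Type*}
    {E : Matrix c c ℂ →ₗ[ℂ] Matrix d d ℂ} (hE : IsCPTP E) {τ : Fin 2 → X → Matrix c c ℂ}
    (hτ : ∀ a x, (τ a x).PosSemidef) {T : Matrix c c ℂ} (hT : ∀ x, ∑ a, τ a x = T)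
    {S : X → Matrix d d ℂ} (hS : ∀ a x, S x * E (τ a x) = (-1 : ℂ) ^ (a : ℕ) • E (τ a x)) :
    ∃ Λ : Matrix d d ℂ →ₗ[ℂ] Matrix c c ℂ, Λ 1 = Tᴴ * T ∧
      (∀ x, Λ (S x) = Tᴴ * (τ 0 x - τ 1 x)) ∧
      ∀ x x', Λ ((S x)ᴴ * S x') = (τ 0 x - τ 1 x)ᴴ * (τ 0 x' - τ 1 x') := by
  classical
  obtain ⟨V, rfl, hV⟩ := hE.exists_eq_dilatedChannel
  have hVT := Matrix.one_mul (V * T)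
  rw [← one_kronecker_one] at hVT
  have hVD (x : X) := one_kronecker_mul_mul_sum (hτ · x) (hS · x)
  simp only [hT] at hVD
  refine ⟨heisenbergDual (V * T), ?_, fun x => ?_, fun x x' => ?_⟩
  · simpa using heisenbergDual_conjTranspose_mul hV hVT hVT
  · simpa using heisenbergDual_conjTranspose_mul hV hVT (hVD x)
  · exact heisenbergDual_conjTranspose_mul hV (hVD x) (hVD x')

end Dilation

section Obstruction

variable {d : Type*} [DecidableEq d]

/-- The two-outcome measurement `(1 + (-1)^a S) / 2` of an observable `S` with eigenvalues `±1`. -/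
def spectralMeasurement (S : Matrix d d ℂ) (a : Fin 2) : Matrix d d ℂ :=
  (1 / 2 : ℂ) • (1 + (-1 : ℂ) ^ (a : ℕ) • S)

theorem sum_spectralMeasurement (S : Matrix d d ℂ) : ∑ a, spectralMeasurement S a = 1 := by
  simp only [Fin.sum_univ_two, spectralMeasurement, Fin.val_zero, Fin.val_one, pow_zero, pow_one]
  module

variable [Fintype d]

theorem mul_spectralMeasurement {S : Matrix d d ℂ} (hS : S * S = 1) (a : Fin 2) :
    S * spectralMeasurement S a = (-1 : ℂ) ^ (a : ℕ) • spectralMeasurement S a := by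
  rw [spectralMeasurement, Matrix.mul_smul, Matrix.mul_add, Matrix.mul_smul, hS, Matrix.mul_one]
  fin_cases a <;> simp <;> module

theorem isPOVM_spectralMeasurement {S : Matrix d d ℂ} (hS : S.IsHermitian) (hS2 : S * S = 1) :
    IsPOVM (spectralMeasurement S) := by
  refine ⟨fun a => ?_, sum_spectralMeasurement S⟩
  have hherm : (spectralMeasurement S a)ᴴ = spectralMeasurement S a := by
    simp [spectralMeasurement, hS.eq]
  have hproj : spectralMeasurement S a * spectralMeasurement S a = spectralMeasurement S a := by
    nth_rewrite 1 [spectralMeasurement]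
    rw [Matrix.smul_mul, Matrix.add_mul, Matrix.smul_mul, mul_spectralMeasurement hS2, smul_smul,
      ← mul_pow, Matrix.one_mul]
    norm_num [← two_smul ℂ, smul_smul]
  rw [← hproj]
  nth_rewrite 1 [← hherm]
  exact posSemidef_conjTranspose_mul_self _

omit [DecidableEq d] in
theorem eq_zero_of_isHermitian_of_mul_eq_zero {T D : Matrix d d ℂ} (hT : T.IsHermitian)
    (hTD : T * D = 0) (hsq : D * D = T * T) : T = 0 := by
  have hTTT : Tᴴ * T * T = 0 := by
    rw [hT.eq, Matrix.mul_assoc, ← hsq, ← Matrix.mul_assoc, hTD, Matrix.zero_mul]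
  rw [conjTranspose_mul_self_mul_eq_zero] at hTTT
  rwa [← conjTranspose_mul_self_eq_zero, hT.eq]

/-- In a quantum realisation, the relation `S x₁ y * S x₂ y = γ y • S x₃ y` between Bob's
observables lifts to a relation between matrices that do not depend on `y`; hence `γ` cannot depend
on `y` either. -/
theorem not_isQuantumRealisable_of_mul_eq_smul {X Y d : Type} [Fintype d] [DecidableEq d]
    [Nonempty d] {σ : Fin 2 → X → Y → Matrix d d ℂ} {r : ℂ} (hr : r ≠ 0)
    {S : X → Y → Matrix d d ℂ} (hS : ∀ x y, (S x y).IsHermitian) (hS2 : ∀ x y, S x y * S x y = 1)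
    (hσ : ∀ a x y, σ a x y = r • spectralMeasurement (S x y) a) {x₁ x₂ x₃ : X} {γ : Y → ℂ}
    (hmul : ∀ y, S x₁ y * S x₂ y = γ y • S x₃ y) {y₀ y₁ : Y} (hγ : γ y₀ ≠ γ y₁) :
    ¬ IsQuantumRealisable.{u} σ := by
  intro hreal
  obtain ⟨n, τ, T, E, hτ, hT, hE, hστ⟩ := hreal.exists_steered
  have hTh : T.IsHermitian := hT x₁ ▸ (posSemidef_sum _ fun a _ => hτ a x₁).isHermitian
  have hDh (x : X) : (τ 0 x - τ 1 x).IsHermitian := (hτ 0 x).isHermitian.sub (hτ 1 x).isHermitian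
  have heigen (y : Y) (a : Fin 2) (x : X) :
      S x y * E y (τ a x) = (-1 : ℂ) ^ (a : ℕ) • E y (τ a x) := by
    rw [← hστ, hσ, Matrix.mul_smul, mul_spectralMeasurement (hS2 x y), smul_comm]
  choose Λ hΛ1 hΛ hΛmul using fun y => (hE y).exists_linearMap_conjTranspose_mul hτ hT (heigen y)
  have hD₁D₂ (y : Y) :
      (τ 0 x₁ - τ 1 x₁)ᴴ * (τ 0 x₂ - τ 1 x₂) = γ y • (T * (τ 0 x₃ - τ 1 x₃)) := by
    rw [← hΛmul y, (hS x₁ y).eq, hmul, map_smul, hΛ, hTh.eq]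
  have hTD₃ : T * (τ 0 x₃ - τ 1 x₃) = 0 := by
    have h := (hD₁D₂ y₀).symm.trans (hD₁D₂ y₁)
    rw [← sub_eq_zero, ← sub_smul] at h
    exact (smul_eq_zero.1 h).resolve_left (sub_ne_zero.2 hγ)
  have hD₃D₃ : (τ 0 x₃ - τ 1 x₃) * (τ 0 x₃ - τ 1 x₃) = T * T := by
    have h := hΛmul y₀ x₃ x₃
    rwa [(hS x₃ y₀).eq, hS2, hΛ1, hTh.eq, (hDh x₃).eq, eq_comm] at h
  have hT0 : T = 0 := eq_zero_of_isHermitian_of_mul_eq_zero hTh hTD₃ hD₃D₃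
  have hsum : ∑ a, σ a x₁ y₀ = r • 1 := by
    simp only [hσ, ← Finset.smul_sum, sum_spectralMeasurement]
  simp only [hστ, ← map_sum, hT, hT0, map_zero] at hsum
  exact smul_ne_zero hr one_ne_zero hsum.symm

end Obstruction

section Example

theorem pauli_isHermitian (x : Fin 3) : (pauli x).IsHermitian := by
  fin_cases x <;> ext i j <;> fin_cases i <;> fin_cases j <;> simp [pauli]

theorem pauli_mul_self (x : Fin 3) : pauli x * pauli x = 1 := by
  fin_cases x <;> ext i j <;> fin_cases i <;> fin_cases j <;> simp [pauli]

theorem pauli_trace (x : Fin 3) : (pauli x).trace = 0 := by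
  fin_cases x <;> simp [pauli, trace_fin_two]

theorem pauli_zero_mul_two : pauli 0 * pauli 2 = -Complex.I • pauli 1 := by
  ext i j; fin_cases i <;> fin_cases j <;> simp [pauli]

theorem pauli_two_mul_zero : pauli 2 * pauli 0 = Complex.I • pauli 1 := by
  ext i j; fin_cases i <;> fin_cases j <;> simp [pauli]

theorem pauli_transpose (x : Fin 3) : (pauli x)ᵀ = (-1 : ℂ) ^ deltaY x • pauli x := by
  fin_cases x <;> ext i j <;> fin_cases i <;> fin_cases j <;> simp [pauli, deltaY]

theorem bobMap_zero (P : Matrix (Fin 2) (Fin 2) ℂ) : bobMap 0 P = P :=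
  rfl

theorem bobMap_one (P : Matrix (Fin 2) (Fin 2) ℂ) : bobMap 1 P = Pᵀ :=
  rfl

theorem IsPOVM.bobMap {B : Type*} [Fintype B] {N : B → Matrix (Fin 2) (Fin 2) ℂ} (hN : IsPOVM N)
    (y : Fin 2) : IsPOVM fun b => bobMap y (N b) := by
  match y with
  | 0 => exact hN
  | 1 => exact ⟨fun b => (hN.1 b).transpose, by
      simp only [bobMap_one, ← transpose_sum, hN.2, transpose_one]⟩

theorem trace_bobMap (y : Fin 2) (P : Matrix (Fin 2) (Fin 2) ℂ) :
    (bobMap y P).trace = P.trace := by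
  match y with
  | 0 => rfl
  | 1 => exact trace_transpose P

theorem trace_mul_bobMap (y : Fin 2) (P Q : Matrix (Fin 2) (Fin 2) ℂ) :
    (P * bobMap y Q).trace = (bobMap y P * Q).trace := by
  match y with
  | 0 => rfl
  | 1 => rw [bobMap_one, bobMap_one, ← trace_transpose, transpose_mul, transpose_transpose,
      trace_mul_comm]

theorem isHermitian_bobMap {P : Matrix (Fin 2) (Fin 2) ℂ} (hP : P.IsHermitian) (y : Fin 2) :
    (bobMap y P).IsHermitian := by
  match y with
  | 0 => exact hP
  | 1 => exact hP.transpose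

theorem bobMap_mul_self {P : Matrix (Fin 2) (Fin 2) ℂ} (hP : P * P = 1) (y : Fin 2) :
    bobMap y P * bobMap y P = 1 := by
  match y with
  | 0 => exact hP
  | 1 => rw [bobMap_one, ← transpose_mul, hP, transpose_one]

theorem bobMap_smul_spectralMeasurement (y : Fin 2) (r : ℂ) (S : Matrix (Fin 2) (Fin 2) ℂ)
    (a : Fin 2) :
    bobMap y (r • spectralMeasurement S a) = r • spectralMeasurement (bobMap y S) a := by
  match y with
  | 0 => rfl
  | 1 => simp [bobMap_one, spectralMeasurement]

theorem bobMap_pauli (x : Fin 3) (y : Fin 2) :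
    bobMap y (pauli x) = (-1 : ℂ) ^ (deltaY x * if y = 1 then 1 else 0) • pauli x := by
  match y with
  | 0 => simp [bobMap_zero]
  | 1 => simp [bobMap_one, pauli_transpose]

/-- The transpose reverses the product `X Z = -i Y`, which flips the sign. -/
theorem bobMap_pauli_zero_mul_bobMap_pauli_two (y : Fin 2) :
    bobMap y (pauli 0) * bobMap y (pauli 2) =
      (if y = 0 then -Complex.I else Complex.I) • bobMap y (pauli 1) := by
  match y with
  | 0 => exact pauli_zero_mul_two
  | 1 => rw [bobMap_one, bobMap_one, ← transpose_mul, pauli_two_mul_zero]; simp [bobMap_one]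

theorem exampleAssemblage_eq_smul (a : Fin 2) (x : Fin 3) (y : Fin 2) :
    exampleAssemblage a x y = (1 / 2 : ℂ) • spectralMeasurement (bobMap y (pauli x)) a := by
  rw [exampleAssemblage, spectralMeasurement, bobMap_pauli, smul_smul, smul_smul, ← pow_add]
  norm_num

theorem pauliMeasurement_eq_transpose (a : Fin 2) (x : Fin 3) :
    pauliMeasurement a x = (spectralMeasurement (pauli x) a)ᵀ := by
  rw [pauliMeasurement, spectralMeasurement, transpose_smul, transpose_add, transpose_one,
    transpose_smul, pauli_transpose, smul_smul, pow_add]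

theorem isPOVM_pauliMeasurement (x : Fin 3) : IsPOVM fun a => pauliMeasurement a x := by
  simp only [pauliMeasurement_eq_transpose]
  exact (isPOVM_spectralMeasurement (pauli_isHermitian x) (pauli_mul_self x)).bobMap 1

theorem isNonSignalling_exampleAssemblage : IsNonSignalling exampleAssemblage := by
  have hsum (x : Fin 3) (y : Fin 2) : ∑ a, exampleAssemblage a x y = (1 / 2 : ℂ) • 1 := by
    simp only [exampleAssemblage_eq_smul, ← Finset.smul_sum, sum_spectralMeasurement]
  refine ⟨fun a x y => ?_, fun x x' y => by rw [hsum, hsum],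
    ⟨fun _ _ => 1 / 2, fun a x y => ?_⟩, fun x y => ?_⟩
  · rw [exampleAssemblage_eq_smul]
    exact ((isPOVM_spectralMeasurement (isHermitian_bobMap (pauli_isHermitian x) y)
      (bobMap_mul_self (pauli_mul_self x) y)).1 a).smul (by norm_num [Complex.le_def])
  · rw [exampleAssemblage_eq_smul]
    norm_num [spectralMeasurement, trace_bobMap, pauli_trace]
  · rw [hsum, trace_smul, trace_one]
    norm_num

theorem maxEntangled_apply (i j k l : Fin 2) :
    maxEntangled (i, j) (k, l) = if i = j ∧ k = l then 1 / 2 else 0 := by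
  have hsqrt : ((√2 : ℝ) : ℂ)⁻¹ * ((√2 : ℝ) : ℂ)⁻¹ = 1 / 2 := by
    rw [← mul_inv, ← Complex.ofReal_mul, Real.mul_self_sqrt (by norm_num)]
    norm_num
  by_cases hij : i = j <;> by_cases hkl : k = l <;>
    simp [maxEntangled, vecMulVec_apply, phiPlus, hij, hkl]
  simpa using hsqrt

theorem isDensityMatrix_maxEntangled : IsDensityMatrix maxEntangled := by
  refine ⟨posSemidef_vecMulVec_self_star _, ?_⟩
  simp only [trace, diag_apply, Fintype.sum_prod_type, maxEntangled_apply, Fin.sum_univ_two]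
  norm_num

theorem traceFst_maxEntangled (P : Matrix (Fin 2) (Fin 2) ℂ) :
    traceFst ((P ⊗ₖ (1 : Matrix (Fin 2) (Fin 2) ℂ)) * maxEntangled) = (1 / 2 : ℂ) • Pᵀ := by
  ext i j
  simp only [traceFst, of_apply, mul_apply, Fintype.sum_prod_type, maxEntangled_apply,
    kroneckerMap_apply, Fin.sum_univ_two, Matrix.smul_apply, transpose_apply, smul_eq_mul,
    one_apply]
  fin_cases i <;> fin_cases j <;> simp <;> ring

theorem exampleAssemblage_eq_bobMap (a : Fin 2) (x : Fin 3) (y : Fin 2) :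
    exampleAssemblage a x y = bobMap y (traceFst
      ((pauliMeasurement a x ⊗ₖ (1 : Matrix (Fin 2) (Fin 2) ℂ)) * maxEntangled)) := by
  rw [traceFst_maxEntangled, pauliMeasurement_eq_transpose, transpose_transpose,
    bobMap_smul_spectralMeasurement, exampleAssemblage_eq_smul]

theorem trace_mul_exampleAssemblage (N : Matrix (Fin 2) (Fin 2) ℂ) (a : Fin 2) (x : Fin 3)
    (y : Fin 2) : (N * exampleAssemblage a x y).trace =
      ((pauliMeasurement a x ⊗ₖ bobMap y N) * maxEntangled).trace := by
  rw [exampleAssemblage_eq_bobMap, trace_mul_bobMap, ← trace_one_kronecker_mul, ← Matrix.mul_assoc,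
    ← mul_kronecker_mul, Matrix.one_mul, Matrix.mul_one]

theorem isQuantumBell_exampleAssemblage {B W : Type*} [Fintype B]
    (N : B → W → Matrix (Fin 2) (Fin 2) ℂ) (hN : ∀ w, IsPOVM fun b => N b w) (y : W → Fin 2) :
    IsQuantumBell fun (a : Fin 2) (b : B) (x : Fin 3) (w : W) =>
      (N b w * exampleAssemblage a x (y w)).trace :=
  ⟨2, 2, pauliMeasurement, fun b w => bobMap (y w) (N b w), maxEntangled, isPOVM_pauliMeasurement,
    fun w => (hN w).bobMap (y w), isDensityMatrix_maxEntangled,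
    fun _ _ _ _ => trace_mul_exampleAssemblage _ _ _ _⟩

theorem not_isQuantumRealisable_exampleAssemblage :
    ¬ IsQuantumRealisable.{u} exampleAssemblage := by
  refine not_isQuantumRealisable_of_mul_eq_smul (by norm_num)
    (fun x => isHermitian_bobMap (pauli_isHermitian x))
    (fun x => bobMap_mul_self (pauli_mul_self x)) exampleAssemblage_eq_smul
    bobMap_pauli_zero_mul_bobMap_pauli_two (y₀ := 0) (y₁ := 1) ?_
  simpa using neg_ne_self.2 Complex.I_ne_zero

end Example

end

end Steering

theorem theorem2 :
    -- the assemblage is non-signalling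
    Steering.IsNonSignalling Steering.exampleAssemblage ∧
    -- Pauli measurements on a maximally entangled state, then the identity or the transpose
    (∀ a x y, Steering.exampleAssemblage a x y =
      Steering.bobMap y (Steering.traceFst
        ((Steering.pauliMeasurement a x ⊗ₖ (1 : Matrix (Fin 2) (Fin 2) ℂ)) *
          Steering.maxEntangled))) ∧
    -- it has no quantum realisation
    ¬ Steering.IsQuantumRealisable.{u} Steering.exampleAssemblage ∧
    -- every measurement of Bob gives quantum Bell correlations
    (∀ (B : Type v) [Fintype B] (N : B → Matrix (Fin 2) (Fin 2) ℂ), Steering.IsPOVM N →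
      Steering.IsQuantumBell (fun (a : Fin 2) (b : B) (x : Fin 3) (y : Fin 2) =>
        (N b * Steering.exampleAssemblage a x y).trace)) ∧
    -- also if Bob chooses between measurements, labelled by an additional input `z`
    (∀ (B : Type v) [Fintype B] (Z : Type w) (N : B → Z → Matrix (Fin 2) (Fin 2) ℂ),
      (∀ z, Steering.IsPOVM (fun b => N b z)) →
      Steering.IsQuantumBell (fun (a : Fin 2) (b : B) (x : Fin 3) (yz : Fin 2 × Z) =>
        (N b yz.2 * Steering.exampleAssemblage a x yz.1).trace)) := by
  refine ⟨Steering.isNonSignalling_exampleAssemblage, Steering.exampleAssemblage_eq_bobMap,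
    Steering.not_isQuantumRealisable_exampleAssemblage, fun B _ N hN => ?_, fun B _ Z N hN => ?_⟩
  · exact Steering.isQuantumBell_exampleAssemblage (fun b _ => N b) (fun _ => hN) id
  · exact Steering.isQuantumBell_exampleAssemblage (fun b yz => N b yz.2) (fun yz => hN yz.2)
      Prod.fst
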